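/- Let $n\ge 2$. For $0<d\le n$ and $E\subset\mathbb R^n$ let $\mathcal H^{d}_\infty(E)=\inf\{\sum_i r_i^{d}\}$, the infimum being over all countable coverings of $E$ by open balls $B(x_i,r_i)$ with $r_i>0$. For an open set $\Omega\subset\mathbb R^n$ and $f:\Omega\to[0,\infty]$ let $\int_\Omega f\,d\mathcal H^{d}_\infty=\int_0^\infty \mathcal H^{d}_\infty(\{x\in\Omega: f(x)>t\})\,dt$. Let $C^1_0(\Omega)$ be the set of continuously differentiable real functions with compact support in $\Omega$. Let $\delta\in(0,n]$. There is a constant $c>0$ depending only on $n$ and $\delta$ such that for every bounded domain (nonempty, bounded, open, connected set) $\Omega\subset\mathbb R^n$, every $u\in C^1_0(\Omega)$ and every $t>0$, $$\mathcal H^{\delta}_\infty\big(\{x\in\Omega:|u(x)|>t\}\big)^{\frac{n-1}{\delta}}\le\frac ct\Big(\int_\Omega|\nabla u(x)|^{\frac{\delta}{n}}\,d\mathcal H^{\delta}_\infty\Big)^{\frac n\delta}.$$ More generally, for every $\kappa\in[0,1)$ there is a constant $c>0$ depending only on $n$, $\delta$ and $\kappa$ such that for all such $\Omega$, $u$ and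 $t$, $$\mathcal H^{\delta\frac{n-\kappa}{n}}_\infty\big(\{x\in\Omega:|u(x)|>t\}\big)^{\frac{n(n-1)}{\delta(n-\kappa)}}\le\frac ct\Big(\int_\Omega|\nabla u(x)|^{\frac{\delta}{n}}\,d\mathcal H^{\delta}_\infty\Big)^{\frac n\delta}.$$ -/

import Mathlib

open Set MeasureTheory
open scoped ENNReal

/-- The `δ`-dimensional Hausdorff content: the infimum of `∑ r_i ^ δ` over all countable coverings
of `E` by open balls of positive radii. (For `δ > 0` finite coverings give the same infimum: a
finite covering can be padded with balls whose radii have an arbitrarily small `δ`-sum.) -/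
noncomputable def hausdorffContent {n : ℕ} (δ : ℝ) (E : Set (EuclideanSpace ℝ (Fin n))) : ℝ≥0∞ :=
  ⨅ (x : ℕ → EuclideanSpace ℝ (Fin n)) (r : ℕ → ℝ) (_ : ∀ i, 0 < r i)
    (_ : E ⊆ ⋃ i, Metric.ball (x i) (r i)), ∑' i, ENNReal.ofReal (r i ^ δ)

/-- The Choquet integral over `Ω` of a `[0, ∞]`-valued function with respect to the
`δ`-dimensional Hausdorff content. -/
noncomputable def choquetIntegral {n : ℕ} (δ : ℝ) (Ω : Set (EuclideanSpace ℝ (Fin n)))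
    (f : EuclideanSpace ℝ (Fin n) → ℝ≥0∞) : ℝ≥0∞ :=
  ∫⁻ t in Ioi (0 : ℝ), hausdorffContent δ {x ∈ Ω | ENNReal.ofReal t < f x}

/-- A bounded domain: a bounded, nonempty, open and connected set. -/
structure IsBoundedDomain {n : ℕ} (Ω : Set (EuclideanSpace ℝ (Fin n))) : Prop where
  isOpen : IsOpen Ω
  isConnected : IsConnected Ω
  isBounded : Bornology.IsBounded Ω

/-- `u ∈ C¹₀(Ω)`: `u` is continuously differentiable with compact support contained in `Ω`
(functions on `Ω` are identified with their extension by zero). -/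
structure IsC10 {n : ℕ} (Ω : Set (EuclideanSpace ℝ (Fin n)))
    (u : EuclideanSpace ℝ (Fin n) → ℝ) : Prop where
  contDiff : ContDiff ℝ 1 u
  hasCompactSupport : HasCompactSupport u
  tsupport_subset : tsupport u ⊆ Ω

/-! Put `p = δ / n ≤ 1`. Cutting `|∇u|^p` at dyadic levels and covering each level set efficiently
gives balls `B(z_j, r_j)` with weights `α_j`, where `∑ α_j r_j^δ` is at most about `4I`, `I` being
the Choquet integral (`exists_weighted_balls`). Then `|∇u| ≤ ∑ α_j^(1/p) 1_{B_j}`, and integrating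
along rays gives `|u(x)| ≤ K ∑ α_j^(1/p) r_j^n |x - z_j|^(1-n)` (`exists_enorm_le_tsum_edist_rpow`).
Since `p ≤ 1`, the power `p` passes inside the sum, and `n p = δ` turns it into `|u|^p ≤ K^p ∑ α_j
r_j^δ |x - z_j|^(-s)` with `s = p (n - 1)`: a Riesz potential of a discrete measure of mass at most
about `4I`. Superlevel sets of such a potential have small `d`-content for every `d > s`, by a
Vitali covering (`hausdorffContent_lintegral_edist_rpow_neg_gt_le`). For `d = p (n - κ)` the
condition `s < d` is exactly `κ < 1`. -/

/-! ### Elementary properties of Hausdorff content. -/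

theorem ENNReal.rpow_tsum_le_tsum_rpow {ι : Type*} (f : ι → ℝ≥0∞) {p : ℝ} (hp : 0 < p)
    (hp1 : p ≤ 1) : (∑' i, f i) ^ p ≤ ∑' i, f i ^ p := by
  have hfin : ∀ s : Finset ι, (∑ i ∈ s, f i) ^ p ≤ ∑ i ∈ s, f i ^ p := fun s =>
    Finset.le_sum_of_subadditive (fun x : ℝ≥0∞ => x ^ p) (ENNReal.zero_rpow_of_pos hp).le
      (fun a b => ENNReal.rpow_add_le_add_rpow a b hp.le hp1) s f
  have ht : Filter.Tendsto (fun s : Finset ι => (∑ i ∈ s, f i) ^ p) Filter.atTop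
      (nhds ((∑' i, f i) ^ p)) :=
    (ENNReal.continuous_rpow_const.tendsto _).comp ENNReal.summable.hasSum
  exact le_of_tendsto' ht fun s => (hfin s).trans (ENNReal.sum_le_tsum s)

theorem hausdorffContent_mono {n : ℕ} {δ : ℝ} {E F : Set (EuclideanSpace ℝ (Fin n))}
    (h : E ⊆ F) : hausdorffContent δ E ≤ hausdorffContent δ F :=
  iInf_mono fun _ => iInf_mono fun _ => iInf_mono fun _ =>
    le_iInf fun hF => iInf_le_of_le (h.trans hF) le_rfl

/-- Vitali families may be finite or empty, while the content uses sequences. Padding with balls of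
radii `η k ^ δ⁻¹` costs less than `ε`. -/
theorem hausdorffContent_le_tsum {n : ℕ} {δ : ℝ} (hδ : 0 < δ) {ι : Type*} [Countable ι]
    {E : Set (EuclideanSpace ℝ (Fin n))} (x : ι → EuclideanSpace ℝ (Fin n)) (r : ι → ℝ)
    (hr : ∀ i, 0 < r i) (hE : E ⊆ ⋃ i, Metric.ball (x i) (r i)) :
    hausdorffContent δ E ≤ ∑' i, ENNReal.ofReal (r i ^ δ) := by
  refine ENNReal.le_of_forall_pos_le_add fun ε hε _ => ?_
  obtain ⟨η, hη, hsum⟩ := ENNReal.exists_pos_sum_of_countable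
    (ENNReal.coe_ne_zero.2 hε.ne') ℕ
  obtain ⟨e⟩ : Nonempty (ℕ ≃ ι ⊕ ℕ) := by
    obtain ⟨_⟩ := nonempty_denumerable (ι ⊕ ℕ)
    exact ⟨(Denumerable.eqv _).symm⟩
  set X : ι ⊕ ℕ → EuclideanSpace ℝ (Fin n) := Sum.elim x fun _ => 0
  set ρ : ι ⊕ ℕ → ℝ := Sum.elim r fun k => (η k : ℝ) ^ δ⁻¹
  have hρ : ∀ k, 0 < ρ k := by
    rintro (i | k)
    · exact hr i
    · exact Real.rpow_pos_of_pos (hη k) _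
  have hcov : E ⊆ ⋃ k, Metric.ball (X (e k)) (ρ (e k)) := by
    intro y hy
    obtain ⟨i, hi⟩ := mem_iUnion.1 (hE hy)
    exact mem_iUnion.2 ⟨e.symm (Sum.inl i), by simpa [X, ρ] using hi⟩
  calc hausdorffContent δ E ≤ ∑' k, ENNReal.ofReal (ρ (e k) ^ δ) :=
        iInf_le_of_le (fun k => X (e k)) <| iInf_le_of_le (fun k => ρ (e k)) <|
          iInf_le_of_le (fun k => hρ _) <| iInf_le_of_le hcov le_rfl
    _ = ∑' k, ENNReal.ofReal (ρ k ^ δ) := e.tsum_eq fun k => ENNReal.ofReal (ρ k ^ δ)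
    _ = ∑' i, ENNReal.ofReal (r i ^ δ) + ∑' k, (η k : ℝ≥0∞) := by
        rw [Summable.tsum_sum ENNReal.summable ENNReal.summable]
        congr 1
        refine tsum_congr fun k => ?_
        simp only [ρ, Sum.elim_inr]
        rw [← Real.rpow_mul (NNReal.coe_nonneg (η k)), inv_mul_cancel₀ hδ.ne', Real.rpow_one,
          ENNReal.ofReal_coe_nnreal]
    _ ≤ _ := by gcongr

theorem exists_cover_tsum_le {n : ℕ} {δ : ℝ} {E : Set (EuclideanSpace ℝ (Fin n))}
    (hE : hausdorffContent δ E ≠ ∞) {ε : ℝ≥0∞} (hε : ε ≠ 0) :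
    ∃ (x : ℕ → EuclideanSpace ℝ (Fin n)) (r : ℕ → ℝ), (∀ i, 0 < r i) ∧
      E ⊆ ⋃ i, Metric.ball (x i) (r i) ∧
      ∑' i, ENNReal.ofReal (r i ^ δ) ≤ hausdorffContent δ E + ε := by
  have h := ENNReal.lt_add_right hE hε
  conv_lhs at h => rw [hausdorffContent]
  simp only [iInf_lt_iff] at h
  obtain ⟨x, r, hr, hc, hlt⟩ := h
  exact ⟨x, r, hr, hc, hlt.le⟩

/-! ### Atomic decomposition for the Choquet integral. -/

/-- Atomic decomposition: a finite function with finite Choquet integral is dominated by weights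
on a countable family of balls whose weighted content sum is controlled by the integral. -/
theorem exists_weighted_balls {n : ℕ} {δ : ℝ} {Ω : Set (EuclideanSpace ℝ (Fin n))}
    {f : EuclideanSpace ℝ (Fin n) → ℝ≥0∞} (hf : ∀ y, f y ≠ ∞) {S : ℝ≥0∞}
    (hS : choquetIntegral δ Ω f < S) :
    ∃ (x : ℤ × ℕ → EuclideanSpace ℝ (Fin n)) (r : ℤ × ℕ → ℝ) (α : ℤ × ℕ → ℝ≥0∞),
      (∀ j, 0 < r j) ∧ (∀ y ∈ Ω, f y ≠ 0 → ∃ j, y ∈ Metric.ball (x j) (r j) ∧ f y ≤ α j) ∧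
      ∑' j, α j * ENNReal.ofReal (r j ^ δ) ≤ 4 * S := by
  set H : ℝ → ℝ≥0∞ := fun t => hausdorffContent δ {x ∈ Ω | ENNReal.ofReal t < f x} with hHdef
  have hanti : Antitone H := fun s t hst => hausdorffContent_mono fun x hx =>
    ⟨hx.1, (ENNReal.ofReal_le_ofReal hst).trans_lt hx.2⟩
  have hw : ∀ k : ℤ, (0 : ℝ) < 2 ^ k := fun k => zpow_pos two_pos k
  -- The interval has length `2 ^ (k - 1)`, a quarter of the weight `2 ^ (k + 1)`; hence the
  -- constant 4.
  have hslice : ∀ k : ℤ, ENNReal.ofReal (2 ^ (k + 1)) * H (2 ^ k) ≤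
      4 * ∫⁻ t in Ioc ((2 : ℝ) ^ (k - 1)) (2 ^ k), H t := by
    intro k
    have h1 : ∫⁻ t in Ioc ((2 : ℝ) ^ (k - 1)) (2 ^ k), H (2 ^ k) ≤
        ∫⁻ t in Ioc ((2 : ℝ) ^ (k - 1)) (2 ^ k), H t :=
      setLIntegral_mono' measurableSet_Ioc fun t ht => hanti ht.2
    rw [setLIntegral_const, Real.volume_Ioc] at h1
    calc _ = 4 * (H (2 ^ k) * ENNReal.ofReal (2 ^ k - 2 ^ (k - 1))) := by
          have : (2 : ℝ) ^ (k + 1) = 4 * (2 ^ k - 2 ^ (k - 1)) := by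
            rw [zpow_add_one₀ two_ne_zero, zpow_sub_one₀ two_ne_zero]; ring
          rw [this, ENNReal.ofReal_mul (by norm_num)]
          norm_num
          ring
      _ ≤ _ := by gcongr
  have hdisj : Pairwise (Function.onFun Disjoint
      fun k : ℤ => Ioc ((2 : ℝ) ^ (k - 1)) (2 ^ k)) := by
    have key : ∀ i j : ℤ, i < j → Disjoint (Ioc ((2 : ℝ) ^ (i - 1)) (2 ^ i))
        (Ioc ((2 : ℝ) ^ (j - 1)) (2 ^ j)) := by
      intro i j hij
      refine Set.disjoint_left.2 fun t ht ht' => ?_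
      have : (2 : ℝ) ^ i ≤ 2 ^ (j - 1) := zpow_le_zpow_right₀ one_le_two (by omega)
      exact absurd (ht.2.trans this) (not_le.2 ht'.1)
    intro i j hij
    rcases lt_or_gt_of_ne hij with h | h
    · exact key i j h
    · exact (key j i h).symm
  have hsum : ∑' k : ℤ, ENNReal.ofReal (2 ^ (k + 1)) * H (2 ^ k) ≤
      4 * choquetIntegral δ Ω f := by
    calc _ ≤ ∑' k : ℤ, 4 * ∫⁻ t in Ioc ((2 : ℝ) ^ (k - 1)) (2 ^ k), H t :=
          ENNReal.tsum_le_tsum hslice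
      _ = 4 * ∫⁻ t in ⋃ k : ℤ, Ioc ((2 : ℝ) ^ (k - 1)) (2 ^ k), H t := by
          rw [ENNReal.tsum_mul_left, lintegral_iUnion (fun _ => measurableSet_Ioc) hdisj]
      _ ≤ _ := by
          unfold choquetIntegral
          gcongr
          exact iUnion_subset fun k t ht => (hw _).trans ht.1
  have hfin : ∀ k : ℤ, H (2 ^ k) ≠ ∞ := by
    intro k hk
    have h := (ENNReal.le_tsum k).trans hsum
    rw [hk, ENNReal.mul_top (by simpa using hw _)] at h
    exact (ENNReal.mul_lt_top (by norm_num) (hS.trans_le le_top)).ne (top_le_iff.1 h)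
  -- The slack in `hS` pays for near-optimal covers at all levels; level `k` gets error `η k` after
  -- multiplication by its weight.
  have hgap : 4 * (S - choquetIntegral δ Ω f) ≠ 0 :=
    mul_ne_zero (by norm_num) (tsub_pos_of_lt hS).ne'
  obtain ⟨η, hη, hηsum⟩ := ENNReal.exists_pos_sum_of_countable' hgap ℤ
  have hε : ∀ k : ℤ, η k / ENNReal.ofReal (2 ^ (k + 1)) ≠ 0 := fun k =>
    (ENNReal.div_pos (hη k).ne' ENNReal.ofReal_ne_top).ne'
  choose x r hr hcov hle using fun k : ℤ => exists_cover_tsum_le (hfin k) (hε k)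
  refine ⟨fun j => x j.1 j.2, fun j => r j.1 j.2, fun j => ENNReal.ofReal (2 ^ (j.1 + 1)),
    fun j => hr _ _, ?_, ?_⟩
  · intro y hy hy0
    obtain ⟨k, hk⟩ := ENNReal.exists_mem_Ioc_zpow hy0 (hf y) (y := 2) (by norm_num) (by norm_num)
    have h2 : ∀ m : ℤ, (2 : ℝ≥0∞) ^ m = ENNReal.ofReal (2 ^ m) := by
      intro m
      rw [← Real.rpow_intCast, ← ENNReal.ofReal_rpow_of_pos two_pos, ENNReal.rpow_intCast]
      norm_num
    rw [h2, h2] at hk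
    obtain ⟨i, hi⟩ := mem_iUnion.1 (hcov k ⟨hy, hk.1⟩)
    exact ⟨(k, i), hi, hk.2⟩
  · rw [ENNReal.tsum_prod']
    calc _ = ∑' k : ℤ, ENNReal.ofReal (2 ^ (k + 1)) * ∑' i, ENNReal.ofReal (r k i ^ δ) := by
          simp only [ENNReal.tsum_mul_left]
      _ ≤ ∑' k : ℤ, (ENNReal.ofReal (2 ^ (k + 1)) * H (2 ^ k) + η k) := by
          refine ENNReal.tsum_le_tsum fun k => ?_
          refine (mul_le_mul_right (hle k) _).trans ?_
          rw [mul_add, ENNReal.mul_div_cancel (by simpa using hw _) ENNReal.ofReal_ne_top]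
      _ ≤ 4 * choquetIntegral δ Ω f + 4 * (S - choquetIntegral δ Ω f) := by
          rw [ENNReal.tsum_add]
          gcongr
      _ = 4 * S := by rw [← mul_add, add_tsub_cancel_of_le hS.le]

/-! ### Weak-type bounds for Riesz potentials of measures. -/

theorem edist_rpow_neg_le_tsum {X : Type*} [PseudoMetricSpace X] {s R : ℝ} (hs : 0 < s)
    (hR : 0 < R) (x y : X) :
    edist x y ^ (-s) ≤ ENNReal.ofReal (R ^ (-s)) +
      ∑' k : ℕ, (Metric.closedBall x ((1 / 2) ^ k * R)).indicator
        (fun _ => ENNReal.ofReal (((1 / 2) ^ (k + 1) * R) ^ (-s))) y := by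
  have hpos : ∀ k : ℕ, 0 < (1 / 2 : ℝ) ^ k * R := fun k => by positivity
  have hofReal : ∀ a : ℝ, 0 < a → a ≤ dist x y →
      edist x y ^ (-s) ≤ ENNReal.ofReal (a ^ (-s)) := by
    intro a ha hle
    rw [edist_dist, ENNReal.ofReal_rpow_of_pos (ha.trans_le hle)]
    exact ENNReal.ofReal_le_ofReal (Real.rpow_le_rpow_of_nonpos ha hle (by linarith))
  -- At distance zero the kernel is `∞`, and so is the series: every term is at least `R ^ (-s)`.
  rcases (dist_nonneg (x := x) (y := y)).eq_or_lt with h0 | h0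
  · refine le_top.trans (top_le_iff.2 ?_).ge
    refine ENNReal.add_eq_top.2 (Or.inr (top_le_iff.1 ?_))
    have hne : ENNReal.ofReal (R ^ (-s)) ≠ 0 := by
      simpa using Real.rpow_pos_of_pos hR _
    rw [← ENNReal.tsum_const_eq_top_of_ne_zero (α := ℕ) hne]
    refine ENNReal.tsum_le_tsum fun k => ?_
    rw [indicator_of_mem (by rw [Metric.mem_closedBall, dist_comm, ← h0]; exact (hpos k).le)]
    refine ENNReal.ofReal_le_ofReal
      (Real.rpow_le_rpow_of_nonpos (hpos _) ?_ (by linarith))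
    exact mul_le_of_le_one_left hR.le (pow_le_one₀ (by norm_num) (by norm_num))
  rcases le_or_gt R (dist x y) with h1 | h1
  · exact (hofReal R hR h1).trans le_self_add
  obtain ⟨k, hk1, hk2⟩ := exists_nat_pow_near_of_lt_one (x := dist x y / R) (y := 1 / 2)
    (by positivity) ((div_le_one hR).2 h1.le) (by norm_num) (by norm_num)
  refine (hofReal _ (hpos (k + 1)) ((lt_div_iff₀ hR).1 hk1).le).trans
    (le_trans ?_ (le_add_of_nonneg_left zero_le))
  refine le_trans (le_of_eq ?_) (ENNReal.le_tsum k)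
  rw [indicator_of_mem (by rw [Metric.mem_closedBall, dist_comm]; exact (div_le_iff₀ hR).1 hk2)]

/-- Growth of order `d > s` beats the singularity: the dyadic ball of radius `R / 2 ^ k` contributes
a multiple of `q ^ k` with `q = 2 ^ (s - d) < 1`. -/
theorem lintegral_edist_rpow_neg_le {X : Type*} [PseudoMetricSpace X] [MeasurableSpace X]
    [OpensMeasurableSpace X] {s d : ℝ} (hs : 0 < s) (hsd : s < d) :
    ∃ C : ℝ, 0 < C ∧ ∀ (μ : Measure X) (S R : ℝ), 0 ≤ S → 0 < R → μ univ ≤ ENNReal.ofReal S →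
      ∀ x : X, (∀ ρ : ℝ, 0 < ρ → μ (Metric.closedBall x ρ) ≤ ENNReal.ofReal (S * (ρ / R) ^ d)) →
      ∫⁻ y, edist x y ^ (-s) ∂μ ≤ ENNReal.ofReal (C * S * R ^ (-s)) := by
  set q : ℝ := (1 / 2) ^ (d - s) with hq
  have hq0 : 0 < q := by positivity
  have hq1 : q < 1 := Real.rpow_lt_one (by norm_num) (by norm_num) (by linarith)
  have h1q : 0 < 1 - q := by linarith
  refine ⟨1 + 2 ^ s * (1 - q)⁻¹, by positivity, fun μ S R hS hR hμ x hx => ?_⟩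
  have hRs : 0 < R ^ (-s) := Real.rpow_pos_of_pos hR _
  have hterm : ∀ k : ℕ, ENNReal.ofReal (((1 / 2) ^ (k + 1) * R) ^ (-s)) *
      μ (Metric.closedBall x ((1 / 2) ^ k * R)) ≤ ENNReal.ofReal (R ^ (-s) * S * 2 ^ s * q ^ k) := by
    intro k
    refine (mul_le_mul_right (hx _ (by positivity)) _).trans ?_
    rw [← ENNReal.ofReal_mul (by positivity)]
    refine ENNReal.ofReal_le_ofReal (le_of_eq ?_)
    have e1 : (1 / 2 : ℝ) ^ k * R / R = (1 / 2) ^ k := by field_simp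
    have e2 : (((1 / 2 : ℝ) ^ k) ^ (-s)) * ((1 / 2 : ℝ) ^ k) ^ d = q ^ k := by
      rw [← Real.rpow_add (by positivity), hq, ← Real.rpow_natCast, ← Real.rpow_natCast,
        ← Real.rpow_mul (by norm_num), ← Real.rpow_mul (by norm_num)]
      congr 1; ring
    have e3 : (1 / 2 : ℝ) ^ (-s) = 2 ^ s := by
      rw [one_div, Real.inv_rpow (by norm_num), Real.rpow_neg (by norm_num), inv_inv]
    rw [e1, pow_succ, Real.mul_rpow (by positivity) hR.le, Real.mul_rpow (by positivity)
      (by norm_num), e3, ← e2]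
    ring
  have hmeas : ∀ k : ℕ, Measurable ((Metric.closedBall x ((1 / 2 : ℝ) ^ k * R)).indicator
      fun _ : X => ENNReal.ofReal (((1 / 2) ^ (k + 1) * R) ^ (-s))) := fun k =>
    measurable_const.indicator Metric.isClosed_closedBall.measurableSet
  calc ∫⁻ y, edist x y ^ (-s) ∂μ
      ≤ ∫⁻ y, (ENNReal.ofReal (R ^ (-s)) +
        ∑' k : ℕ, (Metric.closedBall x ((1 / 2) ^ k * R)).indicator
          (fun _ => ENNReal.ofReal (((1 / 2) ^ (k + 1) * R) ^ (-s))) y) ∂μ :=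
        lintegral_mono fun y => edist_rpow_neg_le_tsum hs hR x y
    _ = ENNReal.ofReal (R ^ (-s)) * μ univ +
        ∑' k : ℕ, ENNReal.ofReal (((1 / 2) ^ (k + 1) * R) ^ (-s)) *
          μ (Metric.closedBall x ((1 / 2) ^ k * R)) := by
        rw [lintegral_add_left measurable_const, lintegral_const,
          lintegral_tsum fun k => (hmeas k).aemeasurable]
        congr 1
        refine tsum_congr fun k => ?_
        rw [lintegral_indicator_const Metric.isClosed_closedBall.measurableSet]
    _ ≤ ENNReal.ofReal (R ^ (-s)) * ENNReal.ofReal S +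
        ∑' k : ℕ, ENNReal.ofReal (R ^ (-s) * S * 2 ^ s * q ^ k) := by
        gcongr with k
        exact hterm k
    _ = _ := by
        rw [← ENNReal.ofReal_tsum_of_nonneg (fun k => by positivity)
          ((summable_geometric_of_lt_one hq0.le hq1).mul_left _), tsum_mul_left,
          tsum_geometric_of_lt_one hq0.le hq1, ← ENNReal.ofReal_mul hRs.le,
          ← ENNReal.ofReal_add (by positivity) (by positivity)]
        congr 1; ring

/-- Weak-type estimate for Riesz potentials of finite measures in terms of Hausdorff content. -/
theorem hausdorffContent_lintegral_edist_rpow_neg_gt_le {n : ℕ} {s d : ℝ} (hs : 0 < s)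
    (hsd : s < d) :
    ∃ C : ℝ, 0 < C ∧ ∀ (μ : Measure (EuclideanSpace ℝ (Fin n))) (S R : ℝ), 0 < S → 0 < R →
      μ univ ≤ ENNReal.ofReal S →
      hausdorffContent d {x | ENNReal.ofReal (C * S * R ^ (-s)) < ∫⁻ y, edist x y ^ (-s) ∂μ} ≤
        ENNReal.ofReal ((6 * R) ^ d) := by
  obtain ⟨C, hC, hpot⟩ := lintegral_edist_rpow_neg_le (X := EuclideanSpace ℝ (Fin n)) hs hsd
  have hd : 0 < d := hs.trans hsd
  refine ⟨C, hC, fun μ S R hS hR hμ => ?_⟩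
  set E := {x | ENNReal.ofReal (C * S * R ^ (-s)) < ∫⁻ y, edist x y ^ (-s) ∂μ}
  -- A large potential at `x` forces the growth condition to fail at some radius.
  have hex : ∀ x ∈ E, ∃ ρ : ℝ, 0 < ρ ∧
      ENNReal.ofReal (S * (ρ / R) ^ d) < μ (Metric.closedBall x ρ) := by
    intro x hx
    by_contra! h
    exact (not_lt.2 (hpot μ S R hS.le hR hμ x h)) hx
  choose! ρ hρ hρμ using hex
  have hρR : ∀ x ∈ E, ρ x ≤ R := by
    intro x hx
    have h1 := ((hρμ x hx).trans_le ((measure_mono (subset_univ _)).trans hμ)).le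
    rw [ENNReal.ofReal_le_ofReal_iff hS.le, mul_le_iff_le_one_right hS] at h1
    by_contra! h
    exact (not_lt.2 h1) (Real.one_lt_rpow ((one_lt_div hR).2 h) hd)
  -- Vitali enlarges closed balls by 5; the factor 6 below leaves room for open balls.
  obtain ⟨v, hvE, hvd, hvc⟩ := Vitali.exists_disjoint_subfamily_covering_enlargement_closedBall
    E id ρ R hρR 5 (by norm_num)
  have hcount : v.Countable := hvd.countable_of_nonempty_interior fun x hx =>
    ⟨x, Metric.ball_subset_interior_closedBall (Metric.mem_ball_self (hρ x (hvE hx)))⟩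
  have : Countable v := hcount.to_subtype
  have hcov : E ⊆ ⋃ b : v, Metric.ball (b : EuclideanSpace ℝ (Fin n)) (6 * ρ b) := by
    intro x hx
    obtain ⟨b, hb, hsub⟩ := hvc x hx
    refine mem_iUnion.2 ⟨⟨b, hb⟩, Metric.closedBall_subset_ball ?_
      (hsub (Metric.mem_closedBall_self (hρ x hx).le))⟩
    linarith [hρ b (hvE hb)]
  have hmass : ∑' b : v, μ (Metric.closedBall (b : EuclideanSpace ℝ (Fin n)) (ρ b)) ≤
      ENNReal.ofReal S := by
    refine (tsum_meas_le_meas_iUnion_of_disjoint μ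
      (fun _ => Metric.isClosed_closedBall.measurableSet) ?_).trans
        ((measure_mono (subset_univ _)).trans hμ)
    intro a b hab
    exact (hvd a.2 b.2 (Subtype.coe_injective.ne hab))
  calc hausdorffContent d E ≤ ∑' b : v, ENNReal.ofReal ((6 * ρ b) ^ d) :=
        hausdorffContent_le_tsum hd _ _ (fun b => mul_pos (by norm_num) (hρ b (hvE b.2))) hcov
    _ ≤ ∑' b : v, ENNReal.ofReal ((6 * R) ^ d / S) *
          μ (Metric.closedBall (b : EuclideanSpace ℝ (Fin n)) (ρ b)) := by
        refine ENNReal.tsum_le_tsum fun b => ?_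
        refine le_trans (le_of_eq ?_) (mul_le_mul_right (hρμ b (hvE b.2)).le _)
        have hb := hρ b (hvE b.2)
        rw [← ENNReal.ofReal_mul (by positivity), Real.div_rpow hb.le hR.le,
          Real.mul_rpow (by norm_num) hb.le, Real.mul_rpow (by norm_num) hR.le]
        congr 1
        field_simp
    _ ≤ ENNReal.ofReal ((6 * R) ^ d / S) * ENNReal.ofReal S := by
        rw [ENNReal.tsum_mul_left]; gcongr
    _ = _ := by
        rw [← ENNReal.ofReal_mul (by positivity), div_mul_cancel₀ _ hS.ne']

/-! ### Pointwise domination of `u` by a discrete Riesz potential. -/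

theorem enorm_gradient_eq {n : ℕ} (u : EuclideanSpace ℝ (Fin n) → ℝ)
    (x : EuclideanSpace ℝ (Fin n)) : ‖gradient u x‖ₑ = ‖fderiv ℝ u x‖ₑ := by
  rw [gradient, ← ofReal_norm, LinearIsometryEquiv.norm_map, ofReal_norm]

theorem enorm_le_lintegral_enorm_gradient_ray {n : ℕ} {u : EuclideanSpace ℝ (Fin n) → ℝ}
    (hu : ContDiff ℝ 1 u) (hc : HasCompactSupport u) (x : EuclideanSpace ℝ (Fin n))
    {v : EuclideanSpace ℝ (Fin n)} (hv : v ≠ 0) :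
    ‖u x‖ₑ ≤ ∫⁻ s in Iic (0 : ℝ), ‖gradient u (x + s • v)‖ₑ * ‖v‖ₑ := by
  have hd : ∀ s : ℝ, HasDerivAt (fun s : ℝ => x + s • v) v s := fun s => by
    simpa using ((hasDerivAt_id s).smul_const v).const_add x
  have hemb : Topology.IsClosedEmbedding fun s : ℝ => x + s • v :=
    (Homeomorph.addLeft x).isClosedEmbedding.comp (isClosedEmbedding_smul_left hv)
  have h := HasCompactSupport.enorm_le_lintegral_Ici_deriv (f := fun s : ℝ => u (x + s • v))
    (hu.comp (by fun_prop)) (hc.comp_isClosedEmbedding hemb) 0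
  simp only [zero_smul, add_zero] at h
  refine h.trans (lintegral_mono fun s => ?_)
  have : deriv (fun s : ℝ => u (x + s • v)) s = fderiv ℝ u (x + s • v) v :=
    (((hu.differentiable one_ne_zero _).hasFDerivAt).comp_hasDerivAt s (hd s)).deriv
  rw [this, enorm_gradient_eq]
  exact ContinuousLinearMap.le_opENorm _ _

/-- The set of directions `v` in the ball of radius two for which `x + s • v` lies in a given ball
has small volume, and is empty for large `|s|`. -/
theorem volume_directions_le {n : ℕ} [NeZero n] (x z : EuclideanSpace ℝ (Fin n)) {r : ℝ}
    (hr : 0 < r) {s : ℝ} (hs0 : s ≤ 0) :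
    volume ({v : EuclideanSpace ℝ (Fin n) | 1 < ‖v‖ ∧ ‖v‖ < 2} ∩
        {v | x + s • v ∈ Metric.ball z r}) ≤
      (Icc (-(r + dist x z)) 0).indicator (fun _ =>
        ENNReal.ofReal ((6 * r / (r + dist x z)) ^ n) *
          volume (Metric.ball (0 : EuclideanSpace ℝ (Fin n)) 1)) s := by
  have : Nontrivial (EuclideanSpace ℝ (Fin n)) := by
    have : Nonempty (Fin n) := ⟨0⟩
    infer_instance
  set ρ := dist x z with hρ
  have hρ0 : 0 ≤ ρ := dist_nonneg
  have hD : 0 < r + ρ := by positivity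
  have hball : ∀ v, x + s • v ∈ Metric.ball z r ↔ ‖s • v - (z - x)‖ < r := by
    intro v
    rw [mem_ball_iff_norm]
    congr! 2
    abel
  have hzx : ‖z - x‖ = ρ := by rw [hρ, dist_comm, dist_eq_norm]
  set A := {v : EuclideanSpace ℝ (Fin n) | 1 < ‖v‖ ∧ ‖v‖ < 2} ∩ {v | x + s • v ∈ Metric.ball z r}
    with hA
  have habs : ∀ v ∈ A, |s| ≤ r + ρ ∧ ρ - r < 2 * |s| := by
    rintro v ⟨⟨hv1, hv2⟩, hv3⟩
    have hv3 := (hball v).1 hv3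
    have h1 := norm_sub_norm_le (s • v) (z - x)
    have h2 := norm_sub_norm_le (z - x) (s • v)
    rw [norm_sub_rev (z - x)] at h2
    rw [hzx, norm_smul, Real.norm_eq_abs] at h1 h2
    constructor <;> nlinarith [abs_nonneg s]
  rcases A.eq_empty_or_nonempty with he | ⟨v₀, hv₀⟩
  · rw [he, measure_empty]; exact zero_le
  have hs := habs v₀ hv₀
  rw [indicator_of_mem (mem_Icc.2 ⟨neg_le_of_abs_le hs.1, hs0⟩)]
  have hn : Module.finrank ℝ (EuclideanSpace ℝ (Fin n)) = n := by simp
  -- If `r < ρ / 2`, then `6|s| > 3(ρ - r) > r + ρ`, so `r / |s|` is at most `6r / (r + ρ)`.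
  -- Otherwise `6r / (r + ρ) ≥ 2` and the whole annulus fits.
  rcases lt_or_ge r (ρ / 2) with hlt | hge
  · have hs1 : 0 < |s| := by linarith [hs.2]
    have hsne : s ≠ 0 := abs_pos.1 hs1
    have hsub : A ⊆ Metric.ball (s⁻¹ • (z - x)) (r / |s|) := by
      intro v hv
      have h3 := (hball v).1 hv.2
      rw [mem_ball_iff_norm, lt_div_iff₀ hs1, mul_comm, ← Real.norm_eq_abs, ← norm_smul, smul_sub,
        smul_inv_smul₀ hsne]
      exact h3
    refine (measure_mono hsub).trans ?_
    rw [Measure.addHaar_ball volume _ (by positivity), hn]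
    gcongr ENNReal.ofReal (?_ ^ n) * _
    rw [div_le_div_iff₀ hs1 hD]
    nlinarith [hs.2]
  · have hsub : A ⊆ Metric.ball 0 2 := fun v hv => by simpa using hv.1.2
    refine (measure_mono hsub).trans ?_
    rw [Measure.addHaar_ball volume _ (by positivity), hn]
    gcongr ENNReal.ofReal (?_ ^ n) * _
    rw [le_div_iff₀ hD]
    linarith

/-- After swapping the integrals, `s` ranges over length `D = r + dist x z` and the directions have
volume at most a multiple of `(r / D) ^ n`; the product `r ^ n * D ^ (1 - n)` is bounded by the
kernel as `D ≥ dist x z`. -/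
theorem lintegral_directions_indicator_ball_le {n : ℕ} [NeZero n]
    (x z : EuclideanSpace ℝ (Fin n)) {r : ℝ} (hr : 0 < r) (a : ℝ≥0∞) :
    ∫⁻ v in {v : EuclideanSpace ℝ (Fin n) | 1 < ‖v‖ ∧ ‖v‖ < 2}, ∫⁻ s in Iic (0 : ℝ),
        (Metric.ball z r).indicator (fun _ => a) (x + s • v) ≤
      a * (ENNReal.ofReal (6 ^ n) * volume (Metric.ball (0 : EuclideanSpace ℝ (Fin n)) 1) *
        (ENNReal.ofReal (r ^ n) * edist x z ^ (-((n : ℝ) - 1)))) := by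
  have hn1 : (0 : ℝ) ≤ n - 1 := by
    have : 1 ≤ n := Nat.one_le_iff_ne_zero.2 (NeZero.ne n)
    have : (1 : ℝ) ≤ n := by exact_mod_cast this
    linarith
  set W := volume (Metric.ball (0 : EuclideanSpace ℝ (Fin n)) 1)
  set D := r + dist x z with hDdef
  have hD : 0 < D := by positivity
  have hmeas : Measurable (Function.uncurry fun (v : EuclideanSpace ℝ (Fin n)) (s : ℝ) =>
      (Metric.ball z r).indicator (fun _ => a) (x + s • v)) :=
    (measurable_const.indicator Metric.isOpen_ball.measurableSet).comp
      (by fun_prop : Measurable fun p : EuclideanSpace ℝ (Fin n) × ℝ => x + p.2 • p.1)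
  have hkernel : ENNReal.ofReal D * ENNReal.ofReal ((6 * r / D) ^ n) ≤
      ENNReal.ofReal (6 ^ n) * (ENNReal.ofReal (r ^ n) * edist x z ^ (-((n : ℝ) - 1))) := by
    have h1 : ENNReal.ofReal D ^ (-((n : ℝ) - 1)) ≤ edist x z ^ (-((n : ℝ) - 1)) := by
      rw [ENNReal.rpow_neg, ENNReal.rpow_neg]
      refine ENNReal.inv_le_inv.2 (ENNReal.rpow_le_rpow ?_ hn1)
      rw [edist_dist]
      exact ENNReal.ofReal_le_ofReal (by linarith)
    refine le_trans (le_of_eq ?_) (mul_le_mul_right (mul_le_mul_right h1 _) _)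
    rw [ENNReal.ofReal_rpow_of_pos hD, ← ENNReal.ofReal_mul hD.le,
      ← ENNReal.ofReal_mul (by positivity), ← ENNReal.ofReal_mul (by positivity)]
    congr 1
    rw [neg_sub, Real.rpow_sub hD, Real.rpow_one, Real.rpow_natCast, div_pow, mul_pow]
    field_simp
  rw [lintegral_lintegral_swap hmeas.aemeasurable]
  calc ∫⁻ s in Iic (0 : ℝ), ∫⁻ v in {v : EuclideanSpace ℝ (Fin n) | 1 < ‖v‖ ∧ ‖v‖ < 2},
        (Metric.ball z r).indicator (fun _ => a) (x + s • v)
      ≤ ∫⁻ s in Iic (0 : ℝ), (Icc (-D) 0).indicator (fun _ =>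
          a * (ENNReal.ofReal ((6 * r / D) ^ n) * W)) s := by
        refine setLIntegral_mono' measurableSet_Iic fun s hs => ?_
        have hpre : MeasurableSet {v : EuclideanSpace ℝ (Fin n) | x + s • v ∈ Metric.ball z r} :=
          (by fun_prop : Measurable fun v : EuclideanSpace ℝ (Fin n) => x + s • v)
            Metric.isOpen_ball.measurableSet
        have h := mul_le_mul_right (volume_directions_le x z hr hs) a
        change ∫⁻ v in _, ({v | x + s • v ∈ Metric.ball z r}).indicator (fun _ => a) v ≤ _
        rw [lintegral_indicator_const hpre, Measure.restrict_apply hpre, inter_comm]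
        refine h.trans (le_of_eq ?_)
        by_cases hs' : s ∈ Icc (-D) 0
        · rw [indicator_of_mem hs', indicator_of_mem hs']
        · rw [indicator_of_notMem hs', indicator_of_notMem hs', mul_zero]
    _ ≤ ∫⁻ s, (Icc (-D) 0).indicator (fun _ =>
          a * (ENNReal.ofReal ((6 * r / D) ^ n) * W)) s := setLIntegral_le_lintegral _ _
    _ = a * (W * (ENNReal.ofReal D * ENNReal.ofReal ((6 * r / D) ^ n))) := by
        rw [lintegral_indicator_const measurableSet_Icc, Real.volume_Icc, zero_sub, neg_neg]
        ring
    _ ≤ a * (W * (ENNReal.ofReal (6 ^ n) *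
          (ENNReal.ofReal (r ^ n) * edist x z ^ (-((n : ℝ) - 1))))) := by gcongr
    _ = _ := by ring

/-- A compactly supported `C¹` function whose gradient is dominated by a sum of weighted balls is
pointwise dominated by the corresponding discrete Riesz potential. -/
theorem exists_enorm_le_tsum_edist_rpow (n : ℕ) (hn : n ≠ 0) :
    ∃ C : ℝ, 0 < C ∧ ∀ (u : EuclideanSpace ℝ (Fin n) → ℝ), ContDiff ℝ 1 u →
      HasCompactSupport u → ∀ {ι : Type} [Countable ι] (z : ι → EuclideanSpace ℝ (Fin n))
      (r : ι → ℝ) (a : ι → ℝ≥0∞), (∀ j, 0 < r j) →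
      (∀ y, ‖gradient u y‖ₑ ≤ ∑' j, (Metric.ball (z j) (r j)).indicator (fun _ => a j) y) →
      ∀ x, ‖u x‖ₑ ≤ ENNReal.ofReal C *
        ∑' j, a j * (ENNReal.ofReal (r j ^ n) * edist x (z j) ^ (-((n : ℝ) - 1))) := by
  have : NeZero n := ⟨hn⟩
  have : Nonempty (Fin n) := ⟨0⟩
  set A := {v : EuclideanSpace ℝ (Fin n) | 1 < ‖v‖ ∧ ‖v‖ < 2} with hA
  set W := volume (Metric.ball (0 : EuclideanSpace ℝ (Fin n)) 1) with hW
  have hAo : IsOpen A := (isOpen_lt continuous_const continuous_norm).inter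
    (isOpen_lt continuous_norm continuous_const)
  have hAne : A.Nonempty := by
    obtain ⟨v, hv⟩ := exists_norm_eq (EuclideanSpace ℝ (Fin n)) (c := 3 / 2) (by norm_num)
    exact ⟨v, by rw [hA, mem_ofPred_eq, hv]; norm_num⟩
  have hA0 : volume A ≠ 0 := (hAo.measure_pos volume hAne).ne'
  have hAtop : volume A ≠ ∞ := ((measure_mono fun v hv => by simpa using hv.2).trans_lt
    (measure_ball_lt_top (x := (0 : EuclideanSpace ℝ (Fin n))) (r := 2))).ne
  have hW0 : W ≠ 0 := (Metric.measure_ball_pos volume _ one_pos).ne'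
  have hWtop : W ≠ ∞ := measure_ball_lt_top.ne
  set K : ℝ≥0∞ := (volume A)⁻¹ * (2 * (ENNReal.ofReal (6 ^ n) * W)) with hK
  have hK0 : K ≠ 0 := mul_ne_zero (ENNReal.inv_ne_zero.2 hAtop)
    (mul_ne_zero two_ne_zero (mul_ne_zero (by simp) hW0))
  have hKtop : K ≠ ∞ := ENNReal.mul_ne_top (ENNReal.inv_ne_top.2 hA0)
    (ENNReal.mul_ne_top (by norm_num) (ENNReal.mul_ne_top ENNReal.ofReal_ne_top hWtop))
  refine ⟨K.toReal, ENNReal.toReal_pos hK0 hKtop, fun u hu hc ι _ z r a hr hg x => ?_⟩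
  rw [ENNReal.ofReal_toReal hKtop]
  set φ : ι → EuclideanSpace ℝ (Fin n) → ℝ≥0∞ := fun j =>
    (Metric.ball (z j) (r j)).indicator fun _ => a j
  have hφ : ∀ j, Measurable (φ j) := fun j =>
    measurable_const.indicator Metric.isOpen_ball.measurableSet
  have hφ2 : ∀ j, Measurable (Function.uncurry fun (v : EuclideanSpace ℝ (Fin n)) (s : ℝ) =>
      φ j (x + s • v)) := fun j => (hφ j).comp
    (by fun_prop : Measurable fun p : EuclideanSpace ℝ (Fin n) × ℝ => x + p.2 • p.1)
  -- Averaging the ray estimate over the annulus `A` replaces polar coordinates; the factor 2 bounds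
  -- `‖v‖`.
  have hint : ‖u x‖ₑ * volume A ≤ 2 * ∑' j, a j * (ENNReal.ofReal (6 ^ n) * W *
      (ENNReal.ofReal (r j ^ n) * edist x (z j) ^ (-((n : ℝ) - 1)))) := by
    calc ‖u x‖ₑ * volume A = ∫⁻ v in A, ‖u x‖ₑ := (setLIntegral_const _ _).symm
      _ ≤ ∫⁻ v in A, 2 * ∫⁻ s in Iic (0 : ℝ), ∑' j, φ j (x + s • v) := by
          refine setLIntegral_mono' hAo.measurableSet fun v hv => ?_
          have hv0 : v ≠ 0 := norm_pos_iff.1 (one_pos.trans hv.1)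
          have hv2 : ‖v‖ₑ ≤ 2 := by
            rw [← ofReal_norm]
            exact ENNReal.ofReal_le_ofNat.2 hv.2.le
          rw [← lintegral_const_mul' _ _ (by norm_num)]
          refine (enorm_le_lintegral_enorm_gradient_ray hu hc x hv0).trans
            (lintegral_mono fun s => ?_)
          rw [mul_comm]
          exact mul_le_mul' hv2 (hg _)
      _ = 2 * ∑' j, ∫⁻ v in A, ∫⁻ s in Iic (0 : ℝ), φ j (x + s • v) := by
          have hφ3 : ∀ j, Measurable fun v => ∫⁻ s in Iic (0 : ℝ), φ j (x + s • v) := fun j =>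
            (hφ2 j).lintegral_prod_right'
          rw [lintegral_const_mul' _ _ (by norm_num), ← lintegral_tsum fun j =>
            (hφ3 j).aemeasurable]
          congr 1
          refine lintegral_congr fun v => ?_
          exact lintegral_tsum fun j => ((hφ2 j).comp measurable_prodMk_left).aemeasurable
      _ ≤ _ := by
          gcongr with j
          exact lintegral_directions_indicator_ball_le x (z j) (hr j) (a j)
  have h2 := mul_le_mul_right hint (volume A)⁻¹
  rw [mul_left_comm, ENNReal.inv_mul_cancel hA0 hAtop, mul_one] at h2
  refine h2.trans (le_of_eq ?_)
  rw [hK, ← ENNReal.tsum_mul_left, ← ENNReal.tsum_mul_left, ← ENNReal.tsum_mul_left]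
  refine tsum_congr fun j => ?_
  ring

/-! ### The weak Sobolev inequality. -/

theorem weak_sobolev_hausdorffContent (n : ℕ) (hn : 2 ≤ n) (δ : ℝ) (hδ : 0 < δ) (hδn : δ ≤ n)
    (κ : ℝ) (hκ1 : κ < 1) :
    ∃ c : ℝ, 0 < c ∧
      ∀ (Ω : Set (EuclideanSpace ℝ (Fin n))) (u : EuclideanSpace ℝ (Fin n) → ℝ), IsC10 Ω u →
      ∀ t : ℝ, 0 < t →
        hausdorffContent (δ * ((n : ℝ) - κ) / (n : ℝ)) {x ∈ Ω | t < |u x|} ^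
            (((n : ℝ) * ((n : ℝ) - 1)) / (δ * ((n : ℝ) - κ))) ≤
          ENNReal.ofReal (c / t) *
            choquetIntegral δ Ω (fun x => ‖gradient u x‖ₑ ^ (δ / (n : ℝ))) ^ ((n : ℝ) / δ) := by
  have hn2 : (2 : ℝ) ≤ n := by exact_mod_cast hn
  have hn0 : (0 : ℝ) < n := by linarith
  have hn1 : (0 : ℝ) < n - 1 := by linarith
  have hnκ : (0 : ℝ) < n - κ := by linarith
  set p := δ / (n : ℝ) with hp
  have hp0 : 0 < p := div_pos hδ hn0
  have hp1 : p ≤ 1 := (div_le_one hn0).2 hδn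
  set s := p * (n - 1) with hs
  set d := δ * ((n : ℝ) - κ) / n with hd
  have hdp : d = p * (n - κ) := by rw [hd, hp]; ring
  have hs0 : 0 < s := mul_pos hp0 hn1
  have hsd : s < d := by rw [hdp]; exact mul_lt_mul_of_pos_left (by linarith) hp0
  have hd0 : 0 < d := hs0.trans hsd
  obtain ⟨C, hC, hweak⟩ := hausdorffContent_lintegral_edist_rpow_neg_gt_le (n := n) hs0 hsd
  obtain ⟨K, hK, hpt⟩ := exists_enorm_le_tsum_edist_rpow n (by omega)
  refine ⟨6 ^ ((n : ℝ) - 1) * (K * (C * 4) ^ p⁻¹), by positivity, fun Ω u hu t ht => ?_⟩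
  set c := 6 ^ ((n : ℝ) - 1) * (K * (C * 4) ^ p⁻¹) with hc
  have hexp : (n : ℝ) * (n - 1) / (δ * (n - κ)) = (n - 1) / d := by rw [hd]; field_simp
  have hnδ : (n : ℝ) / δ = p⁻¹ := by rw [hp, inv_div]
  rw [hexp, hnδ]
  set I := choquetIntegral δ Ω fun x => ‖gradient u x‖ₑ ^ p with hI
  have hgrad0 : ∀ y, y ∉ Ω → ‖gradient u y‖ₑ = 0 := by
    intro y hy
    have hy' : y ∉ tsupport u := fun h => hy (hu.tsupport_subset h)
    have h0 : fderiv ℝ u y = 0 :=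
      Function.notMem_support.1 fun h => hy' (support_fderiv_subset ℝ h)
    rw [enorm_gradient_eq, h0, ← ofReal_norm, norm_zero, ENNReal.ofReal_zero]
  have hmain : ∀ S : ℝ, I < ENNReal.ofReal S →
      hausdorffContent d {x ∈ Ω | t < |u x|} ^ (((n : ℝ) - 1) / d) ≤
        ENNReal.ofReal (c / t) * ENNReal.ofReal S ^ p⁻¹ := by
    intro S hIS
    have hS : 0 < S := ENNReal.ofReal_pos.1 (bot_le.trans_lt hIS)
    obtain ⟨z, r, α, hr, hα, hsum⟩ := exists_weighted_balls
      (fun y => ENNReal.rpow_ne_top_of_nonneg hp0.le enorm_ne_top) hIS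
    have hg : ∀ y, ‖gradient u y‖ₑ ≤
        ∑' j, (Metric.ball (z j) (r j)).indicator (fun _ => α j ^ p⁻¹) y := by
      intro y
      rcases eq_or_ne (‖gradient u y‖ₑ) 0 with h0 | h0
      · rw [h0]; exact zero_le
      have hyΩ : y ∈ Ω := by_contra fun h => h0 (hgrad0 y h)
      obtain ⟨j, hj, hle⟩ := hα y hyΩ (by
        simp [ENNReal.rpow_eq_zero_iff, h0, hp0.not_gt])
      refine le_trans ?_ (ENNReal.le_tsum j)
      rw [indicator_of_mem hj]
      exact (ENNReal.le_rpow_inv_iff hp0).2 hle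
    set μ : Measure (EuclideanSpace ℝ (Fin n)) :=
      Measure.sum fun j => (α j * ENNReal.ofReal (r j ^ δ)) • Measure.dirac (z j) with hμdef
    have hμ : μ univ ≤ ENNReal.ofReal (4 * S) := by
      rw [hμdef, Measure.sum_apply _ MeasurableSet.univ, ENNReal.ofReal_mul (by norm_num)]
      simpa using hsum
    have hupot : ∀ x, ‖u x‖ₑ ^ p ≤ ENNReal.ofReal (K ^ p) * ∫⁻ y, edist x y ^ (-s) ∂μ := by
      intro x
      calc ‖u x‖ₑ ^ p ≤ (ENNReal.ofReal K * ∑' j, α j ^ p⁻¹ *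
            (ENNReal.ofReal (r j ^ n) * edist x (z j) ^ (-((n : ℝ) - 1)))) ^ p :=
            ENNReal.rpow_le_rpow (hpt u hu.contDiff hu.hasCompactSupport z r _ hr hg x) hp0.le
        _ ≤ ENNReal.ofReal (K ^ p) * ∑' j, (α j ^ p⁻¹ *
            (ENNReal.ofReal (r j ^ n) * edist x (z j) ^ (-((n : ℝ) - 1)))) ^ p := by
            rw [ENNReal.mul_rpow_of_nonneg _ _ hp0.le, ENNReal.ofReal_rpow_of_pos hK]
            gcongr
            exact ENNReal.rpow_tsum_le_tsum_rpow _ hp0 hp1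
        _ = _ := by
            rw [hμdef, lintegral_sum_measure]
            congr 1
            refine tsum_congr fun j => ?_
            rw [lintegral_smul_measure, lintegral_dirac' _ (by fun_prop), smul_eq_mul,
              ENNReal.mul_rpow_of_nonneg _ _ hp0.le, ENNReal.mul_rpow_of_nonneg _ _ hp0.le,
              ← ENNReal.rpow_mul, inv_mul_cancel₀ hp0.ne', ENNReal.rpow_one,
              ← ENNReal.rpow_mul, ENNReal.ofReal_rpow_of_pos (pow_pos (hr j) n),
              ← Real.rpow_natCast, ← Real.rpow_mul (hr j).le, ← mul_assoc]
            congr 4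
            · rw [hp]; field_simp
            · rw [hs]; ring
    -- `R` is chosen so that the weak-type threshold, multiplied by `K ^ p`, equals `t ^ p`.
    set R := (K ^ p * (C * (4 * S)) / t ^ p) ^ s⁻¹ with hR
    have hR0 : 0 < R := by positivity
    have hRs : K ^ p * (C * (4 * S) * R ^ (-s)) = t ^ p := by
      rw [hR, ← Real.rpow_mul (by positivity), mul_neg, inv_mul_cancel₀ hs0.ne',
        Real.rpow_neg_one, inv_div]
      field_simp
    have hsub : {x ∈ Ω | t < |u x|} ⊆
        {x | ENNReal.ofReal (C * (4 * S) * R ^ (-s)) < ∫⁻ y, edist x y ^ (-s) ∂μ} := by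
      rintro x ⟨-, hx⟩
      by_contra h
      have h1 := (hupot x).trans (mul_le_mul_right (not_lt.1 h) _)
      rw [← ENNReal.ofReal_mul (by positivity), hRs, ← ENNReal.ofReal_rpow_of_pos ht,
        ENNReal.rpow_le_rpow_iff hp0, Real.enorm_eq_ofReal_abs,
        ENNReal.ofReal_le_ofReal_iff ht.le] at h1
      exact absurd hx (not_lt.2 h1)
    have hcont := (hausdorffContent_mono hsub).trans (hweak μ (4 * S) R (by positivity) hR0 hμ)
    refine (ENNReal.rpow_le_rpow hcont (by positivity)).trans (le_of_eq ?_)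
    rw [ENNReal.ofReal_rpow_of_pos (by positivity), ENNReal.ofReal_rpow_of_pos hS,
      ← ENNReal.ofReal_mul (by positivity), ← Real.rpow_mul (by positivity),
      mul_div_cancel₀ _ hd0.ne', Real.mul_rpow (by norm_num) hR0.le, hR,
      ← Real.rpow_mul (by positivity)]
    -- The content bound `(6R) ^ d` has become `(6R) ^ (n - 1)`, so `κ` enters only through `C`.
    have he : s⁻¹ * ((n : ℝ) - 1) = p⁻¹ := by rw [hs]; field_simp
    have hroot : ∀ a : ℝ, 0 < a → (a ^ p) ^ p⁻¹ = a := fun a ha => by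
      rw [← Real.rpow_mul ha.le, mul_inv_cancel₀ hp0.ne', Real.rpow_one]
    rw [he, Real.div_rpow (by positivity) (by positivity), hroot t ht,
      Real.mul_rpow (by positivity) (by positivity), hroot K hK, ← mul_assoc C,
      Real.mul_rpow (by positivity) hS.le, hc]
    congr 1
    ring
  have hcpos : 0 < c / t := by positivity
  rcases eq_or_ne I ∞ with htop | htop
  · rw [htop, ENNReal.top_rpow_of_pos (by positivity),
      ENNReal.mul_top (by simpa using hcpos)]
    exact le_top
  -- The constant `c` does not depend on `S`, so `S` may decrease to `I`.
  have hlim : Filter.Tendsto (fun k : ℕ => ENNReal.ofReal (c / t) *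
      ENNReal.ofReal (I.toReal + 1 / ((k : ℝ) + 1)) ^ p⁻¹) Filter.atTop
      (nhds (ENNReal.ofReal (c / t) * I ^ p⁻¹)) := by
    refine ENNReal.Tendsto.const_mul ?_ (Or.inr ENNReal.ofReal_ne_top)
    refine (ENNReal.continuous_rpow_const.tendsto _).comp ?_
    have h := ENNReal.tendsto_ofReal
      ((tendsto_one_div_add_atTop_nhds_zero_nat (𝕜 := ℝ)).const_add I.toReal)
    rwa [add_zero, ENNReal.ofReal_toReal htop] at h
  refine ge_of_tendsto' hlim fun k => hmain _ ?_
  rw [ENNReal.lt_ofReal_iff_toReal_lt htop]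
  exact lt_add_of_pos_right _ (by positivity)

theorem corollary1p2 (n : ℕ) (hn : 2 ≤ n) (δ : ℝ) (hδ : 0 < δ) (hδn : δ ≤ n) :
    (∃ c : ℝ, 0 < c ∧
      ∀ Ω : Set (EuclideanSpace ℝ (Fin n)), IsBoundedDomain Ω →
      ∀ u : EuclideanSpace ℝ (Fin n) → ℝ, IsC10 Ω u →
      ∀ t : ℝ, 0 < t →
        hausdorffContent δ {x ∈ Ω | t < |u x|} ^ (((n : ℝ) - 1) / δ) ≤
          ENNReal.ofReal (c / t) *
            choquetIntegral δ Ω (fun x => ‖gradient u x‖ₑ ^ (δ / (n : ℝ))) ^ ((n : ℝ) / δ)) ∧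
    (∀ κ : ℝ, 0 ≤ κ → κ < 1 →
      ∃ c : ℝ, 0 < c ∧
      ∀ Ω : Set (EuclideanSpace ℝ (Fin n)), IsBoundedDomain Ω →
      ∀ u : EuclideanSpace ℝ (Fin n) → ℝ, IsC10 Ω u →
      ∀ t : ℝ, 0 < t →
        hausdorffContent (δ * ((n : ℝ) - κ) / (n : ℝ)) {x ∈ Ω | t < |u x|} ^
            (((n : ℝ) * ((n : ℝ) - 1)) / (δ * ((n : ℝ) - κ))) ≤
          ENNReal.ofReal (c / t) *
            choquetIntegral δ Ω (fun x => ‖gradient u x‖ₑ ^ (δ / (n : ℝ))) ^ ((n : ℝ) / δ)) := by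
  refine ⟨?_, fun κ _ hκ1 => ?_⟩
  · obtain ⟨c, hc, h⟩ := weak_sobolev_hausdorffContent n hn δ hδ hδn 0 one_pos
    have hn0 : (n : ℝ) ≠ 0 := by
      have : n ≠ 0 := by omega
      exact_mod_cast this
    refine ⟨c, hc, fun Ω _ u hu t ht => ?_⟩
    have h := h Ω u hu t ht
    rwa [sub_zero, mul_div_cancel_right₀ _ hn0, mul_comm (n : ℝ), mul_div_mul_right _ _ hn0] at h
  · obtain ⟨c, hc, h⟩ := weak_sobolev_hausdorffContent n hn δ hδ hδn κ hκ1
    exact ⟨c, hc, fun Ω _ u hu t ht => h Ω u hu t ht⟩
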